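/- Let $\mathfrak H_s$ be a complex Hilbert space, $\rho$ a density operator on $\mathfrak H_s$ (a positive trace class operator with $\operatorname{tr}\rho=1$) and $n$ a non-negative integer. Inner products are linear in the second variable. Let $\mathcal T=\mathcal B(\mathfrak H_s)\otimes_{alg}\cdots\otimes_{alg}\mathcal B(\mathfrak H_s)$ ($n$ factors), let $\Pi:\mathcal T\to\mathcal B(\mathfrak H_s)$ be the linear map with $\Pi(b_1\otimes\cdots\otimes b_n)=b_n\cdots b_1$, and put $D_\rho(b,b')=\operatorname{tr}\big(\Pi(b')^\dagger\,\Pi(b)\,\rho\big)$ for $b,b'\in\mathcal T$. Then the following hold. 1. The trace defining $D_\rho(b,b')$ exists for all $b,b'\in\mathcal T$. Moreover $D_\rho$ extends the standard decoherence functional: for all projections $h_1,\dots,h_n,k_1,\dots,k_n$ on $\mathfrak H_s$ the trace $\operatorname{tr}(h_n\cdots h_1\,\rho\,k_1\cdots k_n)$ exists and $D_\rho(h_1\otimes\cdots\otimes h_n,\,k_1\otimes\cdots\otimes k_n)=\operatorname{tr}(h_n\cdots h_1\,\rho\,k_1\cdots k_n)$. 2. There are a complex Hilbert space $\mathcal H$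 and a linear map $R_\rho$ from $\mathcal T$ onto a dense subspace of $\mathcal H$ such that $D_\rho(b,b')=\langle R_\rho(b'),R_\rho(b)\rangle$ for all $b,b'\in\mathcal T$. 3. If $n\ge 2$, then for every such $\mathcal H$ and $R_\rho$ the map $R_\rho$ is unbounded if and only if $\mathfrak H_s$ is infinite dimensional. Here $\mathcal T$ carries the norm induced by the operator norm of $\mathcal B(\mathfrak H_s\otimes\cdots\otimes\mathfrak H_s)$ ($n$ factors), and unbounded means that there is no constant $C$ with $\|R_\rho(b)\|\le C\|b\|$ for all $b\in\mathcal T$. -/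

import Mathlib

open scoped TensorProduct InnerProductSpace ComplexOrder

universe u

section TensorPower

variable {H : Type u} [NormedAddCommGroup H] [InnerProductSpace ℂ H] {n : ℕ}

/-- The product functional `⨂ x_i ↦ ∏ ⟪y_i, x_i⟫` on the algebraic tensor power of `H`. -/
noncomputable def prodFunctional (y : Fin n → H) : (⨂[ℂ] _ : Fin n, H) →ₗ[ℂ] ℂ :=
  PiTensorProduct.lift
    ((MultilinearMap.mkPiAlgebra ℂ (Fin n) ℂ).compLinearMap fun i => innerₛₗ ℂ (y i))

theorem prodFunctional_tprod (y x : Fin n → H) :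
    prodFunctional y (PiTensorProduct.tprod ℂ x) = ∏ i, ⟪y i, x i⟫_ℂ := by
  simp [prodFunctional]

theorem prodFunctional_update_add (y : Fin n → H) (i : Fin n) (a b : H) :
    prodFunctional (Function.update y i (a + b)) =
      prodFunctional (Function.update y i a) + prodFunctional (Function.update y i b) := by
  ext x
  have key : ∀ c : H, (∏ j, ⟪Function.update y i c j, x j⟫_ℂ) =
      ⟪c, x i⟫_ℂ * ∏ j ∈ Finset.univ.erase i, ⟪y j, x j⟫_ℂ := by
    intro c
    rw [← Finset.mul_prod_erase _ _ (Finset.mem_univ i)]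
    congr 1
    · simp
    · refine Finset.prod_congr rfl fun j hj => ?_
      rw [Function.update_of_ne (Finset.ne_of_mem_erase hj)]
  simp only [LinearMap.compMultilinearMap_apply, LinearMap.add_apply, prodFunctional_tprod, key,
    inner_add_left, add_mul]

theorem prodFunctional_update_smul (y : Fin n → H) (i : Fin n) (r : ℂ) (a : H) :
    prodFunctional (Function.update y i (r • a)) =
      (starRingEnd ℂ r) • prodFunctional (Function.update y i a) := by
  ext x
  have key : ∀ c : H, (∏ j, ⟪Function.update y i c j, x j⟫_ℂ) =
      ⟪c, x i⟫_ℂ * ∏ j ∈ Finset.univ.erase i, ⟪y j, x j⟫_ℂ := by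
    intro c
    rw [← Finset.mul_prod_erase _ _ (Finset.mem_univ i)]
    congr 1
    · simp
    · refine Finset.prod_congr rfl fun j hj => ?_
      rw [Function.update_of_ne (Finset.ne_of_mem_erase hj)]
  simp only [LinearMap.compMultilinearMap_apply, LinearMap.smul_apply, prodFunctional_tprod, key,
    inner_smul_left, smul_eq_mul, mul_assoc]

/-- `tensorForm y x = ⟪x, y⟫`: the sesquilinear form on the algebraic tensor power of `H`, with
its arguments swapped, that is determined by
`tensorForm (⨂ y_i) (⨂ x_i) = ∏ ⟪x_i, y_i⟫`. -/
noncomputable def tensorForm :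
    (⨂[ℂ] _ : Fin n, H) →ₗ[ℂ] (⨂[ℂ] _ : Fin n, H) →ₛₗ[starRingEnd ℂ] ℂ :=
  PiTensorProduct.lift
    { toFun := fun y =>
        { toFun := fun x => starRingEnd ℂ (prodFunctional y x)
          map_add' := fun a b => by simp
          map_smul' := fun r a => by simp }
      map_update_add' := fun {inst} y i a b => by
        ext x
        rw [Subsingleton.elim inst (instDecidableEqFin n)]
        simp [prodFunctional_update_add]
      map_update_smul' := fun {inst} y i r a => by
        ext x
        rw [Subsingleton.elim inst (instDecidableEqFin n)]
        simp [prodFunctional_update_smul] }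

theorem tensorForm_tprod (y x : Fin n → H) :
    tensorForm (PiTensorProduct.tprod ℂ y) (PiTensorProduct.tprod ℂ x) =
      ∏ i, ⟪x i, y i⟫_ℂ := by
  simp [tensorForm, prodFunctional_tprod, map_prod]

theorem exists_sum_tprod (x : ⨂[ℂ] _ : Fin n, H) :
    ∃ (m : ℕ) (c : Fin m → ℂ) (v : Fin m → Fin n → H),
      x = ∑ k, c k • PiTensorProduct.tprod ℂ (v k) := by
  induction x using PiTensorProduct.induction_on with
  | smul_tprod r f => exact ⟨1, fun _ => r, fun _ => f, by simp⟩
  | add x y hx hy =>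
    obtain ⟨m, c, v, rfl⟩ := hx
    obtain ⟨m', c', v', rfl⟩ := hy
    exact ⟨m + m', Fin.append c c', Fin.append v v', by simp [Fin.sum_univ_add]⟩

theorem tensorForm_sum {m : ℕ} (c : Fin m → ℂ) (v : Fin m → Fin n → H) :
    tensorForm (∑ k, c k • PiTensorProduct.tprod ℂ (v k))
        (∑ k, c k • PiTensorProduct.tprod ℂ (v k)) =
      star c ⬝ᵥ (Matrix.of (fun k l => ∏ i, Matrix.gram ℂ (fun k => v k i) k l)).mulVec c := by
  simp only [map_sum, map_smul, LinearMap.sum_apply, LinearMap.smul_apply, LinearMap.map_smulₛₗ,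
    tensorForm_tprod, dotProduct, Matrix.mulVec, Matrix.of_apply, Matrix.gram_apply, smul_eq_mul,
    Finset.mul_sum, Pi.star_apply, RCLike.star_def]
  refine Finset.sum_congr rfl fun k _ => Finset.sum_congr rfl fun l _ => ?_
  ring

theorem posSemidef_prod_sub_prod {m : ℕ} {ι : Type*} (s : Finset ι)
    (A B : ι → Matrix (Fin m) (Fin m) ℂ) (hA : ∀ i, (A i).PosSemidef)
    (hAB : ∀ i, (B i - A i).PosSemidef) :
    (Matrix.of fun k l => ∏ i ∈ s, A i k l).PosSemidef ∧
    (Matrix.of fun k l => ∏ i ∈ s, B i k l).PosSemidef ∧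
    ((Matrix.of fun k l => ∏ i ∈ s, B i k l) -
      Matrix.of fun k l => ∏ i ∈ s, A i k l).PosSemidef := by
  classical
  induction s using Finset.induction_on with
  | empty =>
    have h1 : (Matrix.of fun _ _ => (1 : ℂ) : Matrix (Fin m) (Fin m) ℂ).PosSemidef := by
      have := Matrix.posSemidef_gram ℂ (fun _ : Fin m => (1 : ℂ))
      have e : (Matrix.of fun _ _ => (1 : ℂ) : Matrix (Fin m) (Fin m) ℂ) =
          Matrix.gram ℂ (fun _ : Fin m => (1 : ℂ)) := by
        ext k l
        simp [Matrix.gram_apply]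
      rw [e]
      exact this
    refine ⟨by simpa using h1, by simpa using h1, ?_⟩
    simpa using Matrix.PosSemidef.zero
  | insert a s ha ih =>
    obtain ⟨h1, h2, h3⟩ := ih
    have hB : (B a).PosSemidef := by simpa using (hAB a).add (hA a)
    refine ⟨?_, ?_, ?_⟩
    · have e : (Matrix.of fun k l => ∏ i ∈ insert a s, A i k l) =
          (A a).hadamard (Matrix.of fun k l => ∏ i ∈ s, A i k l) := by
        ext k l
        simp [Finset.prod_insert ha]
      rw [e]
      exact (hA a).hadamard h1
    · have e : (Matrix.of fun k l => ∏ i ∈ insert a s, B i k l) =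
          (B a).hadamard (Matrix.of fun k l => ∏ i ∈ s, B i k l) := by
        ext k l
        simp [Finset.prod_insert ha]
      rw [e]
      exact hB.hadamard h2
    · have e : ((Matrix.of fun k l => ∏ i ∈ insert a s, B i k l) -
          Matrix.of fun k l => ∏ i ∈ insert a s, A i k l) =
          (B a - A a).hadamard (Matrix.of fun k l => ∏ i ∈ s, B i k l) +
          (A a).hadamard ((Matrix.of fun k l => ∏ i ∈ s, B i k l) -
            Matrix.of fun k l => ∏ i ∈ s, A i k l) := by
        ext k l
        simp [Finset.prod_insert ha]
        ring
      rw [e]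
      exact ((hAB a).hadamard h2).add ((hA a).hadamard h3)

theorem tensorForm_self_nonneg (x : ⨂[ℂ] _ : Fin n, H) : 0 ≤ tensorForm x x := by
  obtain ⟨m, c, v, rfl⟩ := exists_sum_tprod x
  rw [tensorForm_sum]
  exact (posSemidef_prod_sub_prod Finset.univ (fun i => Matrix.gram ℂ fun k => v k i)
    (fun i => Matrix.gram ℂ fun k => v k i) (fun i => Matrix.posSemidef_gram ℂ _)
    (fun i => by simpa using Matrix.PosSemidef.zero)).1.dotProduct_mulVec_nonneg c

theorem tensorForm_conj (x y : ⨂[ℂ] _ : Fin n, H) :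
    starRingEnd ℂ (tensorForm x y) = tensorForm y x := by
  induction x using PiTensorProduct.induction_on with
  | smul_tprod r f =>
    induction y using PiTensorProduct.induction_on with
    | smul_tprod s g => simp [tensorForm_tprod, map_prod]; ring
    | add a b ha hb => simp only [map_add, LinearMap.add_apply, ha, hb]
  | add a b ha hb => simp only [map_add, LinearMap.add_apply, ha, hb]

variable (H n) in
/-- The `n`-fold algebraic tensor power of the Hilbert space `H`, regarded as a pre-Hilbert space.
It is a type synonym: it carries the Hilbert space inner product and not the projective norm. -/
def PreHilbertTensor : Type u := ⨂[ℂ] _ : Fin n, H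

noncomputable instance : AddCommGroup (PreHilbertTensor H n) :=
  inferInstanceAs (AddCommGroup (⨂[ℂ] _ : Fin n, H))

noncomputable instance : Module ℂ (PreHilbertTensor H n) :=
  inferInstanceAs (Module ℂ (⨂[ℂ] _ : Fin n, H))

/-- The inner product of the tensor power, `⟪⨂ x_i, ⨂ y_i⟫ = ∏ ⟪x_i, y_i⟫`. -/
@[reducible]
noncomputable def PreHilbertTensor.core :
    PreInnerProductSpace.Core ℂ (PreHilbertTensor H n) where
  inner x y := tensorForm (H := H) (n := n) y x
  conj_inner_symm x y := tensorForm_conj (H := H) (n := n) x y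
  re_inner_nonneg x := (Complex.nonneg_iff.mp (tensorForm_self_nonneg (H := H) (n := n) x)).1
  add_left x y z := map_add (tensorForm (H := H) (n := n) z) x y
  smul_left x y r := LinearMap.map_smulₛₗ (tensorForm (H := H) (n := n) y) r x

noncomputable instance : SeminormedAddCommGroup (PreHilbertTensor H n) :=
  @InnerProductSpace.Core.toSeminormedAddCommGroup ℂ _ _ _ _ PreHilbertTensor.core

noncomputable instance : InnerProductSpace ℂ (PreHilbertTensor H n) :=
  InnerProductSpace.ofCore PreHilbertTensor.core

/-- Elementary tensors `x_1 ⊗ ⋯ ⊗ x_n` in the pre-Hilbert space. -/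
noncomputable def PreHilbertTensor.tprod (x : Fin n → H) : PreHilbertTensor H n :=
  PiTensorProduct.tprod ℂ x

theorem PreHilbertTensor.inner_tprod (x y : Fin n → H) :
    ⟪PreHilbertTensor.tprod x, PreHilbertTensor.tprod y⟫_ℂ = ∏ i, ⟪x i, y i⟫_ℂ :=
  tensorForm_tprod y x

/-- The action of the `n`-fold algebraic tensor product of `B(H)` on the tensor power of `H`,
`(b_1 ⊗ ⋯ ⊗ b_n) (x_1 ⊗ ⋯ ⊗ x_n) = b_1 x_1 ⊗ ⋯ ⊗ b_n x_n`. -/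
noncomputable def tensorAction :
    (⨂[ℂ] _ : Fin n, (H →L[ℂ] H)) →ₗ[ℂ] PreHilbertTensor H n →ₗ[ℂ] PreHilbertTensor H n :=
  (PiTensorProduct.piTensorHomMap (R := ℂ) (s := fun _ : Fin n => H) (t := fun _ : Fin n => H)) ∘ₗ
    PiTensorProduct.map fun _ => ContinuousLinearMap.coeLM ℂ

theorem tensorAction_tprod (b : Fin n → H →L[ℂ] H) (x : Fin n → H) :
    tensorAction (PiTensorProduct.tprod ℂ b) (PreHilbertTensor.tprod x) =
      PreHilbertTensor.tprod fun i => b i (x i) := by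
  have h := PiTensorProduct.map_tprod
    (fun _ : Fin n => (ContinuousLinearMap.coeLM ℂ : (H →L[ℂ] H) →ₗ[ℂ] H →ₗ[ℂ] H)) b
  have h2 := PiTensorProduct.piTensorHomMap_tprod_tprod (fun i => (b i : H →ₗ[ℂ] H)) x
  refine Eq.trans ?_ h2
  exact congrArg (fun z => PiTensorProduct.piTensorHomMap z (PiTensorProduct.tprod ℂ x)) h

/-- The action of every element of the algebraic tensor product is a bounded operator. -/
theorem tensorAction_bounded (b : ⨂[ℂ] _ : Fin n, (H →L[ℂ] H)) :
    ∃ C : ℝ, ∀ x : PreHilbertTensor H n, ‖tensorAction b x‖ ≤ C * ‖x‖ := by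
  induction b using PiTensorProduct.induction_on with
  | smul_tprod r f =>
    refine ⟨‖r‖ * ∏ i, ‖f i‖, fun x => ?_⟩
    rw [map_smul, LinearMap.smul_apply, norm_smul, mul_assoc]
    refine mul_le_mul_of_nonneg_left ?_ (norm_nonneg r)
    have hP : 0 ≤ ∏ i, ‖f i‖ := Finset.prod_nonneg fun i _ => norm_nonneg _
    refine le_of_sq_le_sq ?_ (by positivity)
    obtain ⟨m, c, v, hx⟩ := exists_sum_tprod (H := H) (n := n) x
    have hfx : tensorAction (PiTensorProduct.tprod ℂ f) x =
        (∑ k, c k • PiTensorProduct.tprod ℂ (fun i => f i (v k i)) : ⨂[ℂ] _ : Fin n, H) := by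
      rw [show x = _ from hx]
      refine (map_sum (tensorAction (PiTensorProduct.tprod ℂ f)) _ _).trans ?_
      refine Finset.sum_congr rfl fun k _ => ?_
      refine (map_smul (tensorAction (PiTensorProduct.tprod ℂ f)) _ _).trans ?_
      exact congrArg (c k • ·) (tensorAction_tprod f (v k))
    have h := (posSemidef_prod_sub_prod Finset.univ
      (fun i => Matrix.gram ℂ (f i ∘ fun k => v k i))
      (fun i => ‖f i‖ ^ 2 • Matrix.gram ℂ fun k => v k i)
      (fun i => Matrix.posSemidef_gram ℂ _)
      (fun i => Matrix.posSemidef_opNorm_smul_gram_sub_gram (fun k => v k i)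
        (f i))).2.2.dotProduct_mulVec_nonneg c
    rw [Matrix.sub_mulVec, dotProduct_sub] at h
    have e1 : (Matrix.of fun k l => ∏ i, (‖f i‖ ^ 2 • Matrix.gram ℂ fun k => v k i) k l) =
        ((∏ i, ‖f i‖) ^ 2 : ℝ) •
          Matrix.of fun k l => ∏ i, (Matrix.gram ℂ fun k => v k i) k l := by
      ext k l
      simp [Finset.prod_mul_distrib, Finset.prod_pow]
    rw [e1, Matrix.smul_mulVec, dotProduct_smul, ← tensorForm_sum] at h
    have e2 := tensorForm_sum c (fun k i => f i (v k i))
    have e3 : (‖tensorAction (PiTensorProduct.tprod ℂ f) x‖ ^ 2 : ℝ) =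
        (tensorForm (∑ k, c k • PiTensorProduct.tprod ℂ (fun i => f i (v k i)))
          (∑ k, c k • PiTensorProduct.tprod ℂ (fun i => f i (v k i)))).re := by
      rw [← inner_self_eq_norm_sq (𝕜 := ℂ), hfx]
      rfl
    have e4 : (‖x‖ ^ 2 : ℝ) = (tensorForm (∑ k, c k • PiTensorProduct.tprod ℂ (v k))
        (∑ k, c k • PiTensorProduct.tprod ℂ (v k))).re := by
      rw [← inner_self_eq_norm_sq (𝕜 := ℂ), ← hx]
      rfl
    rw [mul_pow, e3, e4, e2]
    have := (Complex.nonneg_iff.mp h).1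
    rw [Complex.sub_re, Complex.smul_re, smul_eq_mul] at this
    exact sub_nonneg.mp this
  | add a b ha hb =>
    obtain ⟨C, hC⟩ := ha
    obtain ⟨C', hC'⟩ := hb
    refine ⟨C + C', fun x => ?_⟩
    rw [map_add, LinearMap.add_apply, add_mul]
    exact (norm_add_le _ _).trans (add_le_add (hC x) (hC' x))

/-- The bounded operator on the pre-Hilbert space `H ⊗ ⋯ ⊗ H` given by an element of the algebraic
tensor product of `B(H)`. -/
noncomputable def tensorOperator (b : ⨂[ℂ] _ : Fin n, (H →L[ℂ] H)) :
    PreHilbertTensor H n →L[ℂ] PreHilbertTensor H n :=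
  LinearMap.mkContinuousOfExistsBound (tensorAction b) (tensorAction_bounded b)

/-- The C*-norm on the `n`-fold algebraic tensor product of `B(H)` that is induced by the operator
norm of `B(H ⊗ ⋯ ⊗ H)`. (The operator norm is computed on the algebraic tensor power, which is
dense in the Hilbert space tensor power.) -/
noncomputable def spatialNorm (b : ⨂[ℂ] _ : Fin n, (H →L[ℂ] H)) : ℝ := ‖tensorOperator b‖

/-- A linear map on the algebraic tensor product of `B(H)` is bounded for the spatial norm. -/
def IsSpatiallyBounded {K : Type*} [NormedAddCommGroup K] [InnerProductSpace ℂ K]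
    (R : (⨂[ℂ] _ : Fin n, (H →L[ℂ] H)) →ₗ[ℂ] K) : Prop :=
  ∃ C : ℝ, ∀ b, ‖R b‖ ≤ C * spatialNorm b

/-- The linear map `Π` with `Π (b_1 ⊗ ⋯ ⊗ b_n) = b_n ⋯ b_1`. -/
noncomputable def timeOrderedProduct : (⨂[ℂ] _ : Fin n, (H →L[ℂ] H)) →ₗ[ℂ] (H →L[ℂ] H) :=
  PiTensorProduct.lift
    ((MultilinearMap.mkPiAlgebraFin ℂ n (H →L[ℂ] H)).domDomCongr Fin.revPerm)

theorem timeOrderedProduct_tprod (b : Fin n → H →L[ℂ] H) :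
    timeOrderedProduct (PiTensorProduct.tprod ℂ b) = (List.ofFn b).reverse.prod := by
  have e : (List.ofFn b).reverse = List.ofFn fun i => b i.rev := by
    apply List.ext_getElem
    · simp
    · intro i h1 h2
      simp only [List.length_ofFn] at h2
      simp only [List.getElem_reverse, List.getElem_ofFn, List.length_ofFn]
      congr 1
      ext
      simp only [Fin.val_rev]
      omega
  rw [e]
  simp [timeOrderedProduct]

end TensorPower

section Decoherence

variable {H : Type u} [NormedAddCommGroup H] [InnerProductSpace ℂ H]

/-- `T` has trace `t`: for every orthonormal basis `e` of `H` the sum `∑ ⟪e_i, T e_i⟫` converges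
(absolutely) to `t`. -/
def HasTrace (T : H →L[ℂ] H) (t : ℂ) : Prop :=
  ∀ (ι : Type u) (e : HilbertBasis ι ℂ H), HasSum (fun i => ⟪e i, T (e i)⟫_ℂ) t

/-- A density operator: a positive trace class operator of trace one. -/
structure IsDensityOperator (ρ : H →L[ℂ] H) : Prop where
  isPositive : ρ.IsPositive
  hasTrace_one : HasTrace ρ 1

variable [CompleteSpace H]

/-- The trace, `tr T = ∑ ⟪e_i, T e_i⟫` for a fixed orthonormal basis `e` of `H`. -/
noncomputable def opTrace (T : H →L[ℂ] H) : ℂ :=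
  ∑' i, ⟪(exists_hilbertBasis ℂ H).choose_spec.choose i,
    T ((exists_hilbertBasis ℂ H).choose_spec.choose i)⟫_ℂ

theorem HasTrace.opTrace_eq {T : H →L[ℂ] H} {t : ℂ} (h : HasTrace T t) : opTrace T = t :=
  (h _ (exists_hilbertBasis ℂ H).choose_spec.choose).tsum_eq

variable {n : ℕ}

/-- The operator `h_n ⋯ h_1 ρ k_1 ⋯ k_n`. -/
noncomputable def historyOperator (ρ : H →L[ℂ] H) (h k : Fin n → H →L[ℂ] H) : H →L[ℂ] H :=
  (List.ofFn h).reverse.prod * ρ * (List.ofFn k).prod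

/-- The standard decoherence functional on homogeneous histories,
`d_ρ(h, k) = tr (h_n ⋯ h_1 ρ k_1 ⋯ k_n)`. -/
noncomputable def standardDecoherence (ρ : H →L[ℂ] H) (h k : Fin n → H →L[ℂ] H) : ℂ :=
  opTrace (historyOperator ρ h k)

/-- The operator `Π(b')† Π(b) ρ`. -/
noncomputable def decoherenceOperator (ρ : H →L[ℂ] H) (b b' : ⨂[ℂ] _ : Fin n, (H →L[ℂ] H)) :
    H →L[ℂ] H :=
  ContinuousLinearMap.adjoint (timeOrderedProduct b') * timeOrderedProduct b * ρ

/-- The extended decoherence functional `D_ρ(b, b') = tr (Π(b')† Π(b) ρ)`. -/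
noncomputable def decoherenceForm (ρ : H →L[ℂ] H) (b b' : ⨂[ℂ] _ : Fin n, (H →L[ℂ] H)) : ℂ :=
  opTrace (decoherenceOperator ρ b b')

/-- `R` represents `D_ρ` on the inner product space `K`: it has dense range and
`D_ρ(b, b') = ⟪R b', R b⟫`. -/
structure RepresentsDecoherence {K : Type*} [NormedAddCommGroup K] [InnerProductSpace ℂ K]
    (ρ : H →L[ℂ] H) (R : (⨂[ℂ] _ : Fin n, (H →L[ℂ] H)) →ₗ[ℂ] K) : Prop where
  denseRange : DenseRange R
  form_eq : ∀ b b', decoherenceForm ρ b b' = ⟪R b', R b⟫_ℂ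

end Decoherence

/-! ### Hilbert–Schmidt families and independence of the basis -/

section Trace

variable {H : Type*} [NormedAddCommGroup H] [InnerProductSpace ℂ H]

/-! Let `S` be a self-adjoint square root of `ρ` and `v i = S (f i)` for an orthonormal basis `f`.
Since `tr ρ = 1`, `S` is Hilbert–Schmidt, and `tr (X ρ Y) = ∑ ⟪v i, Y X (v i)⟫` for all bounded `X`,
`Y` (`IsDensityOperator.exists_vectors`). Both traces in the extension claim become the same sum,
and `D_ρ(b, b')` is the `ℓ²(ι; H)` inner product of the families `Π(b') (v i)` and `Π(b) (v i)`,
which gives the representation.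

Every representation satisfies `‖R b‖² = ∑ ‖Π(b) (v i)‖²`. In finite dimensions, expansion in matrix
units bounds any linear `R`. In infinite dimensions, `∑ |u_k⟩⟨ψ| ⊗ |ψ⟩⟨u_k|` over `m` orthonormal
vectors has spatial norm at most 1, but `Π` maps it to `m |ψ⟩⟨ψ|`; with `ψ` along a nonzero `v j`
this forces `‖R b‖ ≥ m ‖v j‖`. -/

theorem HilbertBasis.hasSum_norm_inner_sq {ι : Type*} (e : HilbertBasis ι ℂ H) (x : H) :
    HasSum (fun i => ‖⟪e i, x⟫_ℂ‖ ^ 2) (‖x‖ ^ 2) := by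
  have h := Complex.hasSum_re (e.hasSum_inner_mul_inner x x)
  have e1 : ∀ i, (⟪x, e i⟫_ℂ * ⟪e i, x⟫_ℂ).re = ‖⟪e i, x⟫_ℂ‖ ^ 2 := fun i => by
    rw [← inner_conj_symm x (e i), Complex.conj_mul', ← Complex.ofReal_pow, Complex.ofReal_re]
  simp only [e1] at h
  have e2 : (⟪x, x⟫_ℂ).re = ‖x‖ ^ 2 := inner_self_eq_norm_sq (𝕜 := ℂ) x
  rwa [e2] at h

theorem summable_norm_inner_sq {ι κ : Type*} (e : HilbertBasis ι ℂ H) (f : HilbertBasis κ ℂ H)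
    {T : H →L[ℂ] H} (hT : Summable fun i => ‖T (e i)‖ ^ 2) :
    Summable fun p : ι × κ => ‖⟪f p.2, T (e p.1)⟫_ℂ‖ ^ 2 := by
  have h0 : 0 ≤ fun p : ι × κ => ‖⟪f p.2, T (e p.1)⟫_ℂ‖ ^ 2 := fun p => sq_nonneg _
  have h1 : ∀ i, Summable fun j => ‖⟪f j, T (e i)⟫_ℂ‖ ^ 2 := fun i =>
    (f.hasSum_norm_inner_sq (T (e i))).summable
  have h2 : (fun i => ∑' j, ‖⟪f j, T (e i)⟫_ℂ‖ ^ 2) = fun i => ‖T (e i)‖ ^ 2 := funext fun i =>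
    (f.hasSum_norm_inner_sq (T (e i))).tsum_eq
  rw [← h2] at hT
  exact (summable_prod_of_nonneg h0).mpr ⟨h1, hT⟩

theorem summable_norm_apply_sq {ι : Type*} {v : ι → H} (hv : Summable fun i => ‖v i‖ ^ 2)
    (X : H →L[ℂ] H) : Summable fun i => ‖X (v i)‖ ^ 2 := by
  refine (hv.mul_left (‖X‖ ^ 2)).of_nonneg_of_le (fun _ => by positivity) fun i => ?_
  rw [← mul_pow]
  gcongr
  exact X.le_opNorm _

variable [CompleteSpace H]

/-- The family `⟪A e_i, f_j⟫ ⟪f_j, B e_i⟫` is absolutely summable because `ab ≤ a² + b²`. Parseval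
in `f` evaluates its sum one way, Parseval in `e` the other. As `f` is arbitrary, this yields traces
independent of the basis. -/
theorem hasSum_inner_adjoint {ι κ : Type*} (e : HilbertBasis ι ℂ H) (f : HilbertBasis κ ℂ H)
    {A B : H →L[ℂ] H} (hA : Summable fun i => ‖A (e i)‖ ^ 2)
    (hB : Summable fun i => ‖B (e i)‖ ^ 2) :
    HasSum (fun j => ⟪B.adjoint (f j), A.adjoint (f j)⟫_ℂ) (∑' i, ⟪A (e i), B (e i)⟫_ℂ) := by
  have hs : Summable fun p : ι × κ => ⟪A (e p.1), f p.2⟫_ℂ * ⟪f p.2, B (e p.1)⟫_ℂ := by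
    refine Summable.of_norm_bounded
      ((summable_norm_inner_sq e f hA).add (summable_norm_inner_sq e f hB)) fun p => ?_
    rw [norm_mul, norm_inner_symm]
    nlinarith [sq_nonneg (‖⟪f p.2, A (e p.1)⟫_ℂ‖ - ‖⟪f p.2, B (e p.1)⟫_ℂ‖),
      sq_nonneg (‖⟪f p.2, A (e p.1)⟫_ℂ‖ + ‖⟪f p.2, B (e p.1)⟫_ℂ‖)]
  have h1 := hs.hasSum.prod_fiberwise fun i => f.hasSum_inner_mul_inner (A (e i)) (B (e i))
  rw [h1.tsum_eq]
  have h2 := (Equiv.prodComm κ ι).hasSum_iff.mpr hs.hasSum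
  refine h2.prod_fiberwise fun j => ?_
  convert! e.hasSum_inner_mul_inner (B.adjoint (f j)) (A.adjoint (f j)) using 2 with i
  simp [ContinuousLinearMap.adjoint_inner_right, ContinuousLinearMap.adjoint_inner_left, mul_comm]

theorem ContinuousLinearMap.IsPositive.exists_sqrt {ρ : H →L[ℂ] H} (hρ : ρ.IsPositive) :
    ∃ S : H →L[ℂ] H, S.adjoint = S ∧ S * S = ρ := by
  have h : 0 ≤ ρ := (ContinuousLinearMap.nonneg_iff_isPositive _).2 hρ
  exact ⟨CFC.sqrt ρ, (CFC.sqrt_nonneg ρ).isSelfAdjoint, CFC.sqrt_mul_sqrt_self ρ h⟩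

end Trace

/-! ### The trace formula for a density operator -/

section DensityOperator

variable {H : Type u} [NormedAddCommGroup H] [InnerProductSpace ℂ H] [CompleteSpace H]

/-- Every `X ρ Y` has a trace, `∑ ⟪v i, Y X (v i)⟫`, where the vectors `v i` are the images of an
orthonormal basis under a self-adjoint square root of the density operator `ρ`. -/
theorem IsDensityOperator.exists_vectors {ρ : H →L[ℂ] H} (hρ : IsDensityOperator ρ) :
    ∃ (ι : Type u) (v : ι → H), Summable (fun i => ‖v i‖ ^ 2) ∧ (∃ i, v i ≠ 0) ∧
      ∀ X Y : H →L[ℂ] H, HasTrace (X * ρ * Y) (∑' i, ⟪v i, Y (X (v i))⟫_ℂ) := by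
  obtain ⟨S, hS, rfl⟩ := hρ.isPositive.exists_sqrt
  obtain ⟨w, f, -⟩ := exists_hilbertBasis ℂ H
  have hin : ∀ x, ⟪x, (S * S) x⟫_ℂ = (‖S x‖ ^ 2 : ℝ) := fun x => by
    rw [mul_apply_eq_comp, ← ContinuousLinearMap.adjoint_inner_left, hS,
      inner_self_eq_norm_sq_to_K]
    norm_cast
  have h1 := hρ.hasTrace_one w f
  simp only [hin] at h1
  have hf : HasSum (fun i => ‖S (f i)‖ ^ 2) 1 :=
    Complex.hasSum_ofReal.mp (by rwa [Complex.ofReal_one])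
  refine ⟨w, fun i => S (f i), hf.summable, ?_, fun X Y κ e => ?_⟩
  · by_contra! h
    simpa [h] using hf.tsum_eq
  · have hX : Summable fun i => ‖(X * S) (f i)‖ ^ 2 := summable_norm_apply_sq hf.summable X
    have hY : Summable fun i => ‖(Y.adjoint * S) (f i)‖ ^ 2 :=
      summable_norm_apply_sq hf.summable Y.adjoint
    -- With `A = Y† S` and `B = X S`, the terms over `e` are `⟪S X† e_i, S Y e_i⟫ = ⟪e_i, X S² Y
    -- e_i⟫`.
    have h := hasSum_inner_adjoint f e hY hX
    have e1 : ∀ Z : H →L[ℂ] H, (Z * S).adjoint = S * Z.adjoint := fun Z => by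
      rw [← ContinuousLinearMap.star_eq_adjoint, star_mul]
      simp only [ContinuousLinearMap.star_eq_adjoint, hS]
    simp only [e1, mul_apply_eq_comp, ContinuousLinearMap.adjoint_adjoint,
      ContinuousLinearMap.adjoint_inner_left] at h
    convert! h using 2 with i
    have e2 := ContinuousLinearMap.adjoint_inner_left S (S (Y (e i))) (X.adjoint (e i))
    have e3 := ContinuousLinearMap.adjoint_inner_left X (S (S (Y (e i)))) (e i)
    rw [hS] at e2
    exact e3.symm.trans e2.symm

end DensityOperator

/-! ### Operators on the tensor power; boundedness in finite dimensions -/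

section TensorAction

variable {H : Type u} [NormedAddCommGroup H] [InnerProductSpace ℂ H] {n : ℕ}

theorem PreHilbertTensor.induction {p : PreHilbertTensor H n → Prop}
    (tprod : ∀ v, p (PreHilbertTensor.tprod v)) (smul : ∀ (c : ℂ) x, p x → p (c • x))
    (add : ∀ x y, p x → p y → p (x + y)) (x : PreHilbertTensor H n) : p x :=
  PiTensorProduct.induction_on (motive := p) x (fun c v => smul c _ (tprod v)) add

theorem PreHilbertTensor.norm_tprod (v : Fin n → H) :
    ‖PreHilbertTensor.tprod v‖ = ∏ i, ‖v i‖ := by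
  have h : ((‖PreHilbertTensor.tprod v‖ : ℂ)) ^ 2 = ((∏ i, ‖v i‖ : ℝ) : ℂ) ^ 2 := by
    have := inner_self_eq_norm_sq_to_K (𝕜 := ℂ) (PreHilbertTensor.tprod v)
    rw [PreHilbertTensor.inner_tprod] at this
    refine this.symm.trans ?_
    rw [Complex.ofReal_prod, ← Finset.prod_pow]
    exact Finset.prod_congr rfl fun i _ => inner_self_eq_norm_sq_to_K _
  exact (pow_left_inj₀ (norm_nonneg _) (by positivity) two_ne_zero).mp (by exact_mod_cast h)

theorem norm_tensorAction_le (b : ⨂[ℂ] _ : Fin n, (H →L[ℂ] H)) (x : PreHilbertTensor H n) :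
    ‖tensorAction b x‖ ≤ spatialNorm b * ‖x‖ :=
  (tensorOperator b).le_opNorm x

theorem spatialNorm_le {b : ⨂[ℂ] _ : Fin n, (H →L[ℂ] H)} {C : ℝ} (hC : 0 ≤ C)
    (h : ∀ x, ‖tensorAction b x‖ ≤ C * ‖x‖) : spatialNorm b ≤ C :=
  ContinuousLinearMap.opNorm_le_bound _ hC h

theorem inner_tensorAction_tprod_left {f g : Fin n → H →L[ℂ] H}
    (h : ∀ i x y, ⟪f i x, y⟫_ℂ = ⟪x, g i y⟫_ℂ) (x y : PreHilbertTensor H n) :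
    ⟪tensorAction (PiTensorProduct.tprod ℂ f) x, y⟫_ℂ =
      ⟪x, tensorAction (PiTensorProduct.tprod ℂ g) y⟫_ℂ := by
  induction x using PreHilbertTensor.induction with
  | tprod v =>
    induction y using PreHilbertTensor.induction with
    | tprod w => simp only [tensorAction_tprod, PreHilbertTensor.inner_tprod, h]
    | smul c y hy => rw [map_smul, inner_smul_right, inner_smul_right, hy]
    | add y z hy hz => rw [map_add, inner_add_right, inner_add_right, hy, hz]
  | smul c x hx => rw [map_smul, inner_smul_left, inner_smul_left, hx]
  | add x z hx hz => rw [map_add, inner_add_left, inner_add_left, hx, hz]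

theorem tensorAction_tprod_comp (f g : Fin n → H →L[ℂ] H) (x : PreHilbertTensor H n) :
    tensorAction (PiTensorProduct.tprod ℂ f) (tensorAction (PiTensorProduct.tprod ℂ g) x) =
      tensorAction (PiTensorProduct.tprod ℂ fun i => f i * g i) x := by
  induction x using PreHilbertTensor.induction with
  | tprod v => simp only [tensorAction_tprod, mul_apply_eq_comp]
  | smul c x hx => simp only [map_smul, hx]
  | add x y hx hy => simp only [map_add, hx, hy]

/-- A tensor product of projections is a contraction. -/
theorem norm_tensorAction_tprod_le {q : Fin n → H →L[ℂ] H}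
    (hs : ∀ i x y, ⟪q i x, y⟫_ℂ = ⟪x, q i y⟫_ℂ) (hq : ∀ i, q i * q i = q i)
    (x : PreHilbertTensor H n) : ‖tensorAction (PiTensorProduct.tprod ℂ q) x‖ ≤ ‖x‖ := by
  set y := tensorAction (PiTensorProduct.tprod ℂ q) x with hy
  -- For `Q` self-adjoint and idempotent, `⟪Qx, Qx⟫ = ⟪x, Qx⟫`; Cauchy–Schwarz then finishes.
  have h1 : ⟪y, y⟫_ℂ = ⟪x, y⟫_ℂ := by
    rw [hy, inner_tensorAction_tprod_left hs, tensorAction_tprod_comp]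
    simp only [hq]
  have h2 : ‖y‖ * ‖y‖ ≤ ‖x‖ * ‖y‖ := by
    rw [← pow_two, ← inner_self_eq_norm_sq (𝕜 := ℂ) y, h1]
    exact re_inner_le_norm x y
  rcases (norm_nonneg y).eq_or_lt with h | h
  · rw [← h]
    exact norm_nonneg x
  · exact le_of_mul_le_mul_right h2 h

/-- In finite dimensions an element of the tensor power of `B(H)` is a combination of tensor
products of matrix units, with its matrix elements as coefficients. -/
theorem eq_sum_matrixUnits {κ : Type*} [Fintype κ] (e : OrthonormalBasis κ ℂ H)
    (b : ⨂[ℂ] _ : Fin n, (H →L[ℂ] H)) :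
    b = ∑ p : Fin n → κ × κ,
      ⟪PreHilbertTensor.tprod fun i => e (p i).1,
        tensorAction b (PreHilbertTensor.tprod fun i => e (p i).2)⟫_ℂ •
        PiTensorProduct.tprod ℂ fun i =>
          InnerProductSpace.rankOne ℂ (e (p i).1) (e (p i).2) := by
  classical
  induction b using PiTensorProduct.induction_on with
  | smul_tprod c f =>
    have hf : ∀ T : H →L[ℂ] H, T = ∑ p : κ × κ, ⟪e p.1, T (e p.2)⟫_ℂ •
        InnerProductSpace.rankOne ℂ (e p.1) (e p.2) := by
      intro T
      ext x
      conv_lhs => rw [← e.sum_repr' x]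
      simp only [map_sum, map_smul, sum_apply, smul_apply,
        InnerProductSpace.rankOne_apply, Fintype.sum_prod_type_right]
      refine Finset.sum_congr rfl fun j _ => ?_
      conv_lhs => rw [← e.sum_repr' (T (e j)), Finset.smul_sum]
      exact Finset.sum_congr rfl fun i _ => smul_comm _ _ _
    simp only [map_smul, LinearMap.smul_apply, inner_smul_right, mul_smul, ← Finset.smul_sum,
      tensorAction_tprod, PreHilbertTensor.inner_tprod]
    congr 1
    conv_lhs => rw [show f = fun i => ∑ p : κ × κ, ⟪e p.1, f i (e p.2)⟫_ℂ •
      InnerProductSpace.rankOne ℂ (e p.1) (e p.2) from funext fun i => hf (f i)]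
    -- Distributing the product over the sums selects one matrix unit per factor, hence the index `p
    -- : Fin n → κ × κ`.
    rw [MultilinearMap.map_sum]
    exact Finset.sum_congr rfl fun p _ => MultilinearMap.map_smul_univ _ _ _
  | add a b ha hb =>
    conv_lhs => rw [ha, hb]
    simp only [map_add, LinearMap.add_apply, inner_add_right, add_smul, Finset.sum_add_distrib]

/-- The coefficients in `eq_sum_matrixUnits` are matrix elements between unit vectors, so each is at
most `spatialNorm b`; the constant sums `‖R‖` over the finitely many tensors of matrix units. -/
theorem isSpatiallyBounded_of_finiteDimensional [FiniteDimensional ℂ H] {K : Type*}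
    [NormedAddCommGroup K] [InnerProductSpace ℂ K] (R : (⨂[ℂ] _ : Fin n, (H →L[ℂ] H)) →ₗ[ℂ] K) :
    IsSpatiallyBounded R := by
  let e := stdOrthonormalBasis ℂ H
  refine ⟨∑ p : Fin n → _ × _, ‖R (PiTensorProduct.tprod ℂ fun i =>
    InnerProductSpace.rankOne ℂ (e (p i).1) (e (p i).2))‖, fun b => ?_⟩
  conv_lhs => rw [eq_sum_matrixUnits e b, map_sum]
  rw [Finset.sum_mul]
  refine (norm_sum_le _ _).trans (Finset.sum_le_sum fun p _ => ?_)
  rw [map_smul, norm_smul, mul_comm]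
  refine mul_le_mul_of_nonneg_left ?_ (norm_nonneg _)
  refine (norm_inner_le_norm _ _).trans ?_
  have h := norm_tensorAction_le b (PreHilbertTensor.tprod fun i => e (p i).2)
  simpa [PreHilbertTensor.norm_tprod] using h

/-! ### The tensors that witness unboundedness -/

open InnerProductSpace in
/-- The element `∑ |u_k⟩⟨ψ| ⊗ |ψ⟩⟨u_k| ⊗ 1 ⊗ ⋯ ⊗ 1`. -/
noncomputable def exchangeTensor {m : ℕ} (n : ℕ) (u : Fin m → H) (ψ : H) :
    ⨂[ℂ] _ : Fin (n + 2), (H →L[ℂ] H) :=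
  ∑ k, PiTensorProduct.tprod ℂ
    (Fin.cons (rankOne ℂ (u k) ψ) (Fin.cons (rankOne ℂ ψ (u k)) fun _ => 1))

/-- The second factor acts after the first, so each summand becomes `|ψ⟩⟨u_k|u_k⟩⟨ψ| = |ψ⟩⟨ψ|` and
the `m` equal terms add up. -/
theorem timeOrderedProduct_exchangeTensor {m : ℕ} {u : Fin m → H} (hu : Orthonormal ℂ u) (ψ : H) :
    timeOrderedProduct (exchangeTensor n u ψ) =
      (m : ℂ) • InnerProductSpace.rankOne ℂ ψ ψ := by
  simp only [exchangeTensor, map_sum, timeOrderedProduct_tprod, List.ofFn_succ, Fin.cons_zero,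
    Fin.cons_succ, List.ofFn_const, List.reverse_cons, List.reverse_replicate, List.prod_append,
    List.prod_replicate, one_pow, one_mul, List.prod_singleton, ContinuousLinearMap.mul_def,
    InnerProductSpace.rankOne_comp_rankOne, inner_self_eq_norm_sq_to_K, hu.1]
  simp [Nat.cast_smul_eq_nsmul]

-- With `T` the action of the tensor and `P` the projection onto the span of `u`, `T†T = |ψ⟩⟨ψ| ⊗ P
-- ⊗ 1 ⊗ ⋯ ⊗ 1`: the cross terms `k ≠ l` vanish by orthonormality. This is a tensor product `q` of
-- projections, hence a contraction whatever `m` is.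
open InnerProductSpace in
theorem spatialNorm_exchangeTensor_le {m : ℕ} {u : Fin m → H} (hu : Orthonormal ℂ u) {ψ : H}
    (hψ : ‖ψ‖ = 1) : spatialNorm (exchangeTensor n u ψ) ≤ 1 := by
  set q : Fin (n + 2) → H →L[ℂ] H :=
    Fin.cons (rankOne ℂ ψ ψ) (Fin.cons (∑ k, rankOne ℂ (u k) (u k)) fun _ => 1) with hq
  have hψ' : ⟪ψ, ψ⟫_ℂ = 1 := by simp [inner_self_eq_norm_sq_to_K, hψ]
  have hu' := orthonormal_iff_ite.mp hu
  have hs : ∀ i x y, ⟪q i x, y⟫_ℂ = ⟪x, q i y⟫_ℂ := by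
    intro i x y
    refine Fin.cases ?_ (fun i => Fin.cases ?_ (fun i => ?_) i) i
    · simp [hq]
    · simp [hq]
    · simp [hq]
  have hi : ∀ i, q i * q i = q i := by
    intro i
    refine Fin.cases ?_ (fun i => Fin.cases ?_ (fun i => ?_) i) i
    · simp [hq, ContinuousLinearMap.mul_def, rankOne_comp_rankOne, hψ]
    · simp only [hq, Fin.cons_zero, Fin.cons_succ, Finset.sum_mul_sum, ContinuousLinearMap.mul_def,
        rankOne_comp_rankOne, hu']
      simp
    · simp [hq]
  have key : ∀ x y, ⟪tensorAction (exchangeTensor n u ψ) x,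
      tensorAction (exchangeTensor n u ψ) y⟫_ℂ =
      ⟪x, tensorAction (PiTensorProduct.tprod ℂ q) y⟫_ℂ := by
    intro x y
    induction x using PreHilbertTensor.induction with
    | tprod v =>
      induction y using PreHilbertTensor.induction with
      | tprod w =>
        simp only [exchangeTensor, map_sum, LinearMap.sum_apply, sum_inner, inner_sum,
          tensorAction_tprod, PreHilbertTensor.inner_tprod, Fin.prod_univ_succ, Fin.cons_zero,
          Fin.cons_succ, hq, rankOne_apply, sum_apply, inner_smul_left, inner_smul_right, hu', hψ',
          inner_conj_symm, one_apply_eq_self, Finset.mul_sum, Finset.sum_mul]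
        simp only [mul_ite, ite_mul, mul_one, mul_zero, zero_mul, Finset.sum_ite_eq',
          Finset.mem_univ, if_true]
      | smul c y hy => simp only [map_smul, inner_smul_right, hy]
      | add y z hy hz => simp only [map_add, inner_add_right, hy, hz]
    | smul c x hx => simp only [map_smul, inner_smul_left, hx]
    | add x z hx hz => simp only [map_add, inner_add_left, hx, hz]
  refine spatialNorm_le zero_le_one fun x => ?_
  rw [one_mul]
  refine le_of_sq_le_sq ?_ (norm_nonneg x)
  rw [← inner_self_eq_norm_sq (𝕜 := ℂ), key, pow_two]
  exact (re_inner_le_norm _ _).trans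
    (mul_le_mul_of_nonneg_left (norm_tensorAction_tprod_le hs hi x) (norm_nonneg x))

theorem exists_orthonormal_of_not_finiteDimensional (h : ¬ FiniteDimensional ℂ H) (m : ℕ) :
    ∃ u : Fin m → H, Orthonormal ℂ u := by
  have hm : (m : Cardinal) ≤ Module.rank ℂ H :=
    (Cardinal.natCast_lt_aleph0.le).trans (not_lt.mp fun h' => h (Module.rank_lt_aleph0_iff.mp h'))
  obtain ⟨v, hv⟩ := exists_linearIndependent_of_le_rank hm
  exact ⟨_, InnerProductSpace.gramSchmidtNormed_orthonormal hv⟩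

end TensorAction

/-! ### Adjoints of histories and the representing space -/

section Decoherence

variable {H : Type u} [NormedAddCommGroup H] [InnerProductSpace ℂ H] [CompleteSpace H] {n : ℕ}

/-- The adjoint reverses the product and so undoes the reversal built into `Π`; the factors are
self-adjoint. -/
theorem adjoint_timeOrderedProduct_tprod {k : Fin n → H →L[ℂ] H}
    (hk : ∀ i, IsStarProjection (k i)) :
    (timeOrderedProduct (PiTensorProduct.tprod ℂ k)).adjoint = (List.ofFn k).prod := by
  have h : ∀ l : List (H →L[ℂ] H), (∀ a ∈ l, star a = a) → star l.reverse.prod = l.prod := by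
    intro l hl
    induction l with
    | nil => simp
    | cons a l ih =>
      rw [List.reverse_cons, List.prod_append, List.prod_singleton, star_mul, List.prod_cons,
        hl a (by simp), ih fun b hb => hl b (by simp [hb])]
  rw [timeOrderedProduct_tprod, ← ContinuousLinearMap.star_eq_adjoint]
  refine h _ fun a ha => ?_
  obtain ⟨i, rfl⟩ := (List.mem_ofFn' _ _).mp ha
  exact (hk i).isSelfAdjoint

/-- The map `a ↦ (P a (v i))_i` lands in `ℓ²(ι; H)`, whose inner product is the given sum. The
closure of its range is complete and makes the range dense. -/
theorem exists_isometric_representation {A : Type*} [AddCommGroup A] [Module ℂ A] {ι : Type u}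
    {v : ι → H} (hv : Summable fun i => ‖v i‖ ^ 2) (P : A →ₗ[ℂ] H →L[ℂ] H) :
    ∃ (K : Type u) (_ : NormedAddCommGroup K) (_ : InnerProductSpace ℂ K) (_ : CompleteSpace K)
      (R : A →ₗ[ℂ] K), DenseRange R ∧
        ∀ a b, ∑' i, ⟪P a (v i), P b (v i)⟫_ℂ = ⟪R a, R b⟫_ℂ := by
  have hmem : ∀ a, Memℓp (fun i => P a (v i)) 2 := fun a => by
    rw [memℓp_gen_iff (by norm_num)]
    simpa using summable_norm_apply_sq hv (P a)
  let L : A →ₗ[ℂ] lp (fun _ : ι => H) 2 :=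
    { toFun := fun a => ⟨fun i => P a (v i), hmem a⟩
      map_add' := fun a b => by
        ext i
        exact congrArg (· (v i)) (map_add P a b)
      map_smul' := fun c a => by
        ext i
        exact congrArg (· (v i)) (map_smul P c a) }
  let M : Submodule ℂ (lp (fun _ : ι => H) 2) := (LinearMap.range L).topologicalClosure
  have hM : ∀ a, L a ∈ M := fun a => Submodule.le_topologicalClosure _ ⟨a, rfl⟩
  have hc : CompleteSpace M :=
    (Submodule.isClosed_topologicalClosure (LinearMap.range L)).completeSpace_coe
  refine ⟨M, inferInstance, inferInstance, hc, L.codRestrict M hM, ?_, fun a b => ?_⟩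
  · rw [DenseRange, Topology.IsInducing.subtypeVal.dense_iff]
    intro x
    rw [← Set.range_comp]
    exact x.2
  · exact (lp.inner_eq_tsum (L a) (L b)).symm

end Decoherence

theorem theorem4p6 {H : Type u} [NormedAddCommGroup H] [InnerProductSpace ℂ H] [CompleteSpace H]
    (n : ℕ) (ρ : H →L[ℂ] H) (hρ : IsDensityOperator ρ) :
    -- the trace defining `D_ρ` exists
    (∀ b b' : ⨂[ℂ] _ : Fin n, (H →L[ℂ] H),
      HasTrace (decoherenceOperator ρ b b') (decoherenceForm ρ b b')) ∧
    -- `D_ρ` extends the standard decoherence functional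
    (∀ h k : Fin n → H →L[ℂ] H, (∀ i, IsStarProjection (h i)) → (∀ i, IsStarProjection (k i)) →
      HasTrace (historyOperator ρ h k) (standardDecoherence ρ h k) ∧
      decoherenceForm ρ (PiTensorProduct.tprod ℂ h) (PiTensorProduct.tprod ℂ k) =
        standardDecoherence ρ h k) ∧
    -- there is a representation
    (∃ (K : Type u) (_ : NormedAddCommGroup K) (_ : InnerProductSpace ℂ K) (_ : CompleteSpace K)
      (R : (⨂[ℂ] _ : Fin n, (H →L[ℂ] H)) →ₗ[ℂ] K), RepresentsDecoherence ρ R) ∧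
    -- every representation is unbounded exactly in infinite dimensions
    (2 ≤ n → ∀ (K : Type u) [NormedAddCommGroup K] [InnerProductSpace ℂ K] [CompleteSpace K]
      (R : (⨂[ℂ] _ : Fin n, (H →L[ℂ] H)) →ₗ[ℂ] K), RepresentsDecoherence ρ R →
      (¬ IsSpatiallyBounded R ↔ ¬ FiniteDimensional ℂ H)) := by
  obtain ⟨ι, v, hv, ⟨j, hj⟩, htr⟩ := hρ.exists_vectors
  have hD : ∀ b b' : ⨂[ℂ] _ : Fin n, (H →L[ℂ] H), HasTrace (decoherenceOperator ρ b b')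
      (∑' i, ⟪timeOrderedProduct b' (v i), timeOrderedProduct b (v i)⟫_ℂ) := fun b b' => by
    have h := htr ((timeOrderedProduct b').adjoint * timeOrderedProduct b) 1
    simpa only [decoherenceOperator, mul_one, one_apply_eq_self, mul_apply_eq_comp,
      ContinuousLinearMap.adjoint_inner_right] using h
  have hform := fun b b' : ⨂[ℂ] _ : Fin n, (H →L[ℂ] H) => (hD b b').opTrace_eq
  refine ⟨fun b b' => ?_, fun h k _ hk => ?_, ?_, fun hn K _ _ _ R hR => not_congr ⟨?_, fun _ =>
    isSpatiallyBounded_of_finiteDimensional R⟩⟩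
  · rw [decoherenceForm, hform]
    exact hD b b'
  -- Splitting the operator around `ρ` gives the same vector sum as `D_ρ`, which replaces an appeal
  -- to cyclicity of the trace.
  · have h1 := htr (List.ofFn h).reverse.prod (List.ofFn k).prod
    rw [standardDecoherence, historyOperator, h1.opTrace_eq]
    refine ⟨h1, ?_⟩
    rw [decoherenceForm, hform, ← adjoint_timeOrderedProduct_tprod hk, ← timeOrderedProduct_tprod]
    simp only [ContinuousLinearMap.adjoint_inner_right]
  · obtain ⟨K, i1, i2, i3, R, hd, hR⟩ := exists_isometric_representation hv timeOrderedProduct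
    exact ⟨K, i1, i2, i3, R, hd, fun b b' => (hform b b').trans (hR b' b)⟩
  · rintro ⟨C, hC⟩
    by_contra hfin
    -- From here on the number of factors is `n + 2`.
    obtain ⟨n, rfl⟩ := Nat.exists_eq_add_of_le' hn
    have hpos : 0 < ‖v j‖ := norm_pos_iff.mpr hj
    set ψ : H := (‖v j‖⁻¹ : ℂ) • v j with hψ
    have hψ1 : ‖ψ‖ = 1 := by
      rw [hψ, norm_smul, norm_inv, Complex.norm_real, norm_norm, inv_mul_cancel₀ hpos.ne']
    have hψv : ‖⟪ψ, v j⟫_ℂ‖ = ‖v j‖ := by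
      rw [hψ, inner_smul_left, norm_mul, inner_self_eq_norm_sq_to_K]
      simp
      field_simp
    -- This `m` makes `m ‖v j‖` exceed `|C|`; the absolute value covers a negative `C`.
    obtain ⟨m, hm⟩ := exists_nat_gt (|C| / ‖v j‖)
    obtain ⟨u, hu⟩ := exists_orthonormal_of_not_finiteDimensional hfin m
    set b := exchangeTensor n u ψ with hb
    -- `‖R b‖²` is the full sum `∑ ‖Π(b) (v i)‖²`, of which only the term `j` is kept.
    have hlow : ‖timeOrderedProduct b (v j)‖ ^ 2 ≤ ‖R b‖ ^ 2 := by
      have h1 : HasSum (fun i => ‖timeOrderedProduct b (v i)‖ ^ 2) (‖R b‖ ^ 2) := by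
        have hs := (summable_norm_apply_sq hv (timeOrderedProduct b)).hasSum
        convert! hs using 1
        have h2 := hR.form_eq b b
        rw [decoherenceForm, hform] at h2
        simp only [inner_self_eq_norm_sq_to_K] at h2
        have h3 : ((∑' i, ‖timeOrderedProduct b (v i)‖ ^ 2 : ℝ) : ℂ) = ((‖R b‖ ^ 2 : ℝ) : ℂ) := by
          rw [Complex.ofReal_tsum]
          push_cast
          exact h2
        exact (Complex.ofReal_injective h3).symm
      exact le_hasSum h1 j fun i _ => sq_nonneg _
    have hval : ‖timeOrderedProduct b (v j)‖ = m * ‖v j‖ := by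
      rw [hb, timeOrderedProduct_exchangeTensor hu, smul_apply, norm_smul,
        InnerProductSpace.rankOne_apply, norm_smul, hψ1, mul_one, hψv, Complex.norm_natCast]
    have hle : (m : ℝ) * ‖v j‖ ≤ |C| := by
      rw [← hval]
      refine (le_of_sq_le_sq hlow (norm_nonneg _)).trans ((hC b).trans ?_)
      have h1 : 0 ≤ spatialNorm b := norm_nonneg (tensorOperator b)
      calc C * spatialNorm b ≤ |C| * spatialNorm b :=
            mul_le_mul_of_nonneg_right (le_abs_self C) h1
        _ ≤ |C| * 1 :=
            mul_le_mul_of_nonneg_left (spatialNorm_exchangeTensor_le hu hψ1) (abs_nonneg C)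
        _ = |C| := mul_one _
    exact absurd hle (not_le.mpr ((div_lt_iff₀ hpos).mp hm))
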